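/- Let $n \ge 1$. For a permutation $\pi = \pi_1\pi_2\cdots\pi_n$ of $\{1,\dots,n\}$ and a letter $x$ of $\pi$, let $\rho_\pi(x)$ be the maximal consecutive subword of $\pi$ consisting of letters immediately to the right of $x$ that are all larger than $x$ (it may be empty). Call $\pi$ a Jacobi permutation if $\rho_\pi(x)$ has even length for every letter $x$ of $\pi$, and say that $\pi$ avoids $123$ if there are no indices $a<b<c$ with $\pi_a<\pi_b<\pi_c$. Then the number $j_n(123)$ of Jacobi permutations of $\{1,\dots,n\}$ that avoid $123$ is $$j_n(123)=\sum_{k=0}^{\lfloor (n-1)/2\rfloor}\frac{1}{2k+1}\binom{n-k-1}{k}\binom{n}{2k}.$$ -/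

import Mathlib

namespace JacobiPerm

/-- The positions occupied by `ρ_π(x)`, where `x = π i` is the letter of `π` at position `i`: the
maximal block of consecutive positions immediately to the right of `i` all of whose letters are
larger than `π i`. A position `j` belongs to it iff `j` is to the right of `i` and every letter
from the one just after position `i` up to and including position `j` is larger than `π i`.
Letters and positions `1, …, n` are indexed by `Fin n` in increasing order. -/
def rho {n : ℕ} (π : Equiv.Perm (Fin n)) (i : Fin n) : Finset (Fin n) :=
  {j | i < j ∧ ∀ k, i < k → k ≤ j → π i < π k}

/-- `π` is Jacobi if `ρ_π(x)` has even length for every letter `x` of `π`. -/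
def IsJacobi {n : ℕ} (π : Equiv.Perm (Fin n)) : Prop :=
  ∀ i, Even (rho π i).card

/-- `f` picks out an occurrence of the pattern `σ` in `π`: the subword of `π` at the positions
`f 0 < f 1 < ⋯ < f (m - 1)` has the same relative order as `σ`, so that its standardization
is `σ`. -/
def IsOccurrence {m n : ℕ} (σ : Equiv.Perm (Fin m)) (π : Equiv.Perm (Fin n))
    (f : Fin m ↪o Fin n) : Prop :=
  ∀ a b, π (f a) < π (f b) ↔ σ a < σ b

/-- `π` avoids `σ`: there is no occurrence of `σ` in `π`. -/
def Avoids {m n : ℕ} (π : Equiv.Perm (Fin n)) (σ : Equiv.Perm (Fin m)) : Prop :=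
  ∀ f : Fin m ↪o Fin n, ¬ IsOccurrence σ π f

/-- The pattern `123`, i.e. the identity permutation of length three. -/
def pattern123 : Equiv.Perm (Fin 3) := Equiv.refl (Fin 3)

/-- The set of Jacobi permutations of length `n` that avoid `σ`. -/
def jacobiAvoiding (n : ℕ) {m : ℕ} (σ : Equiv.Perm (Fin m)) : Set (Equiv.Perm (Fin n)) :=
  {π | IsJacobi π ∧ Avoids π σ}

/-- The number `j_n(σ)` of Jacobi permutations of length `n` that avoid `σ`. -/
noncomputable def jacobiCount (n : ℕ) {m : ℕ} (σ : Equiv.Perm (Fin m)) : ℕ :=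
  (jacobiAvoiding n σ).ncard

end JacobiPerm

/-!
In a `123`-avoiding permutation every letter that is not a left-to-right minimum has no larger
letter to its right, so only the left-to-right minima `x` matter for the Jacobi condition, and
`ρ(x)` consists of all the letters between `x` and the next left-to-right minimum. Thus a
`123`-avoiding permutation is Jacobi iff each left-to-right minimum, together with the block of
letters up to the next one, occupies an odd number of positions.

The permutation can be read off from the values and block lengths of its left-to-right minima: each
further letter has to be the largest one not yet used. Going down through the values `t` and
writing `e` for the length of the block started by `t` (`e = 0` if `t` is not a left-to-right
minimum), the number `q` of unused letters above the current value changes to `q + 1 - e` and must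
stay nonnegative. So the permutations correspond to the walks of length `n` on `ℕ` from `0` to `0`
with such steps, where `e` is `0` or odd. `encard_wordsBelow` is this correspondence at the level
of cardinalities: it shows that words and walks satisfy the same recursion.

The walks are counted as in the cycle lemma. With `φ = 1 + X / (1 - X²)`, the generating function of
the allowed `e`, `stepCount_add` shows by induction on `i` that the number of walks of length `i`
from `0` to `r` is `(r + 1) / (i + 1)` times the coefficient of `X ^ (i - r)` in `φ ^ (i + 1)`; the
induction step is the identity `X (φ ^ (i + 1))' = (i + 1) φ ^ i (X φ')`. Hence the answer is
`1 / (n + 1)` times the coefficient of `X ^ n` in `φ ^ (n + 1)`, and expanding this power by the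
binomial theorem gives the sum term by term.
-/

namespace JacobiPerm

/-! ### Weighted walks and powers of the step series -/

section Walks

open PowerSeries Finset

/-- `stepCount a p q` is the weighted number of walks `q = q₀, q₁, …, q_p = 0` on `ℕ` in which a
step `qᵢ₊₁ = qᵢ + 1 - e` has weight `a e`. -/
def stepCount {R : Type*} [CommSemiring R] (a : ℕ → R) : ℕ → ℕ → R
  | 0, q => if q = 0 then 1 else 0
  | p + 1, q => ∑ x ∈ antidiagonal (q + 1), a x.1 * stepCount a p x.2

/-- The coefficient of `X ^ m` in `(i + 1) φ ^ i (X φ') = X (φ ^ (i + 1))'`. -/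
theorem coeff_pow_mul_weighted (φ : ℚ⟦X⟧) (i m : ℕ) :
    (i + 1 : ℚ) * ∑ x ∈ antidiagonal m, coeff x.1 (φ ^ i) * (x.2 * coeff x.2 φ) =
      m * coeff m (φ ^ (i + 1)) := by
  have hX : ∀ (f : ℚ⟦X⟧) (k : ℕ), coeff k (X * derivative ℚ f) = k * coeff k f := by
    intro f k
    cases k with
    | zero => simp
    | succ k => rw [coeff_succ_X_mul, coeff_derivative]; push_cast; ring
  rw [← hX (φ ^ (i + 1)), derivative_pow]
  have : (X * (((i + 1 : ℕ) : ℚ⟦X⟧) * φ ^ (i + 1 - 1) * derivative ℚ φ) : ℚ⟦X⟧) =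
      C (i + 1 : ℚ) * (φ ^ i * (X * derivative ℚ φ)) := by
    simp; ring
  rw [this, coeff_C_mul, coeff_mul]
  simp only [hX]

/-- A walk of length `p + i` from `0` to `0` is split after `i` steps, at height `x.2`; the number of
ways to get there is `(x.2 + 1) / (i + 1)` times the coefficient of `X ^ x.1` in `φ ^ (i + 1)`. -/
theorem stepCount_add (φ : ℚ⟦X⟧) (hφ : coeff 0 φ = 1) (i p : ℕ) :
    (i + 1 : ℚ) * stepCount (fun e => coeff e φ) (p + i) 0 =
      ∑ x ∈ antidiagonal i,
        (x.2 + 1 : ℚ) * coeff x.1 (φ ^ (i + 1)) * stepCount (fun e => coeff e φ) p x.2 := by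
  induction i generalizing p with
  | zero => simp [hφ]
  | succ i ih =>
    set g := stepCount (fun e => coeff e φ) with hg
    -- The weight `x.2` vanishes at `x.2 = 0`, so the shift `x.2 + 1 ↦ x.2` adds no term.
    have h1 : (i + 1 : ℚ) * g (p + (i + 1)) 0 =
        ∑ x ∈ antidiagonal (i + 1), (x.2 : ℚ) * coeff x.1 (φ ^ (i + 1)) *
          ∑ y ∈ antidiagonal x.2, coeff y.1 φ * g p y.2 := by
      rw [show p + (i + 1) = (p + 1) + i by ring, ih (p + 1), Nat.sum_antidiagonal_succ']
      simp [hg, stepCount]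
    -- Triples `(s, e, r)` with sum `i + 1` are grouped by `s + e` instead of `e + r`.
    have h2 : (i + 1 : ℚ) * g (p + (i + 1)) 0 =
        ∑ x ∈ antidiagonal (i + 1), (∑ y ∈ antidiagonal x.1,
          coeff y.1 (φ ^ (i + 1)) * ((y.2 + x.2 : ℚ) * coeff y.2 φ)) * g p x.2 := by
      rw [h1]
      simp only [mul_sum, sum_mul]
      rw [sum_sigma', sum_sigma']
      refine sum_nbij' (fun z => ⟨(z.1.1 + z.2.1, z.2.2), (z.1.1, z.2.1)⟩)
        (fun z => ⟨(z.2.1, z.2.2 + z.1.2), (z.2.2, z.1.2)⟩) ?_ ?_ ?_ ?_ ?_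
      · rintro ⟨⟨s, k⟩, ⟨e, r⟩⟩; simp; omega
      · rintro ⟨⟨s, k⟩, ⟨e, r⟩⟩; simp; omega
      · rintro ⟨⟨s, k⟩, ⟨e, r⟩⟩; simp
      · rintro ⟨⟨s, k⟩, ⟨e, r⟩⟩; simp
      · rintro ⟨⟨s, k⟩, ⟨e, r⟩⟩
        simp only [mem_sigma, HasAntidiagonal.mem_antidiagonal]
        rintro ⟨-, rfl⟩
        push_cast; ring
    have h3 : ∀ x ∈ antidiagonal (i + 1), (i + 2 : ℚ) * (∑ y ∈ antidiagonal x.1,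
          coeff y.1 (φ ^ (i + 1)) * ((y.2 + x.2 : ℚ) * coeff y.2 φ)) =
        (i + 1) * ((x.2 + 1) * coeff x.1 (φ ^ (i + 2))) := by
      rintro ⟨m, r⟩ hx
      have hx' : (m : ℚ) + r = i + 1 := by exact_mod_cast HasAntidiagonal.mem_antidiagonal.1 hx
      have hw := coeff_pow_mul_weighted φ (i + 1) m
      have hm : coeff m (φ ^ (i + 2)) =
          ∑ y ∈ antidiagonal m, coeff y.1 (φ ^ (i + 1)) * coeff y.2 φ := by
        rw [pow_succ, coeff_mul]
      have hs : ∑ y ∈ antidiagonal m, coeff y.1 (φ ^ (i + 1)) * ((y.2 + r : ℚ) * coeff y.2 φ) =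
          ∑ y ∈ antidiagonal m, coeff y.1 (φ ^ (i + 1)) * (y.2 * coeff y.2 φ) +
            r * coeff m (φ ^ (i + 2)) := by
        rw [hm, mul_sum, ← sum_add_distrib]
        exact sum_congr rfl fun y _ => by ring
      push_cast at hw
      simp only
      rw [hs]
      linear_combination hw + (1 + (i:ℚ) - i) * coeff m (φ ^ (i + 2)) * hx'
    have h4 : (i + 1 : ℚ) ≠ 0 := by positivity
    apply mul_left_cancel₀ h4
    calc (i + 1 : ℚ) * (((i + 1 : ℕ) + 1 : ℚ) * g (p + (i + 1)) 0)
        = (i + 2) * ((i + 1) * g (p + (i + 1)) 0) := by push_cast; ring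
      _ = _ := by
        rw [h2, mul_sum, mul_sum]
        refine sum_congr rfl fun x hx => ?_
        rw [← mul_assoc, h3 x hx]; ring

theorem stepCount_zero_right (φ : ℚ⟦X⟧) (hφ : coeff 0 φ = 1) (n : ℕ) :
    (n + 1 : ℚ) * stepCount (fun e => coeff e φ) n 0 = coeff n (φ ^ (n + 1)) := by
  have h := stepCount_add φ hφ n 0
  rw [zero_add] at h
  rw [h, sum_eq_single (n, 0)]
  · simp [stepCount]
  · rintro ⟨a, b⟩ hab hne
    have : b ≠ 0 := by
      rintro rfl
      exact hne (by simpa using hab)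
    simp [stepCount, this]
  · simp

/-! ### The closed form for odd block lengths -/

/-- The indicator of admissible block lengths: `1` at `0` (the length for a value that is not a
left-to-right minimum) and at the odd numbers. -/
def stepWeight {R : Type*} [CommSemiring R] (e : ℕ) : R := if e = 0 ∨ Odd e then 1 else 0

/-- The coefficients of `(1 - X²)⁻¹ ^ (d + 1)`. -/
theorem one_sub_X_sq_mul_mk (d : ℕ) :
    (1 - X ^ 2 : ℚ⟦X⟧) ^ (d + 1) *
      PowerSeries.mk (fun m => if Even m then ((d + m / 2).choose d : ℚ) else 0) = 1 := by
  induction d with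
  | zero =>
    ext m
    rw [zero_add, pow_one, sub_mul, one_mul, map_sub, coeff_X_pow_mul']
    rcases m with _ | _ | m <;> simp [coeff_one, Nat.even_add_one, parity_simps]
  | succ d ih =>
    rw [pow_succ, mul_assoc]
    convert ih using 2
    ext m
    rw [sub_mul, one_mul, map_sub, coeff_X_pow_mul']
    rcases m with _ | _ | m
    · simp
    · simp
    · simp only [coeff_mk, Nat.even_add_one, not_not, le_add_iff_nonneg_left, zero_le, if_true,
        show m + 1 + 1 - 2 = m by omega, show (m + 1 + 1) / 2 = m / 2 + 1 by omega]
      split_ifs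
      · rw [show d + 1 + (m / 2 + 1) = (d + (m / 2 + 1)) + 1 by ring, Nat.choose_succ_succ,
          show d + 1 + m / 2 = d + (m / 2 + 1) by ring]
        push_cast; ring
      · ring

theorem coeff_stepWeight_pow (n : ℕ) (hn : 1 ≤ n) :
    coeff n ((PowerSeries.mk (stepWeight (R := ℚ))) ^ (n + 1)) =
      ∑ k ∈ Icc 0 ((n - 1) / 2), ((n + 1).choose (2 * k + 1) : ℚ) * ((n - k - 1).choose k : ℚ) := by
  set η : ℚ⟦X⟧ := PowerSeries.mk (fun m => if Even m then (1 : ℚ) else 0) with hη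
  have h1 : (1 - X ^ 2 : ℚ⟦X⟧) * η = 1 := by simpa using one_sub_X_sq_mul_mk 0
  have hpow : ∀ d, η ^ (d + 1) =
      PowerSeries.mk (fun m => if Even m then ((d + m / 2).choose d : ℚ) else 0) := by
    intro d
    have := one_sub_X_sq_mul_mk d
    calc η ^ (d + 1) = η ^ (d + 1) * ((1 - X ^ 2 : ℚ⟦X⟧) ^ (d + 1) * PowerSeries.mk
            (fun m => if Even m then ((d + m / 2).choose d : ℚ) else 0)) := by rw [this, mul_one]
      _ = ((1 - X ^ 2 : ℚ⟦X⟧) * η) ^ (d + 1) * PowerSeries.mk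
            (fun m => if Even m then ((d + m / 2).choose d : ℚ) else 0) := by rw [mul_pow]; ring
      _ = _ := by rw [h1, one_pow, one_mul]
  have hφ : PowerSeries.mk (stepWeight (R := ℚ)) = X * η + 1 := by
    ext m
    cases m with
    | zero => simp [stepWeight]
    | succ m => simp [stepWeight, hη, coeff_one, coeff_succ_X_mul, Nat.odd_add_one]
  rw [hφ, add_pow, map_sum]
  have hterm : ∀ j ∈ range (n + 1 + 1), coeff n ((X * η) ^ j * 1 ^ (n + 1 - j) *
      ((n + 1).choose j : ℚ⟦X⟧)) =
      if j ≤ n then ((n + 1).choose j : ℚ) * coeff (n - j) (η ^ j) else 0 := by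
    intro j _
    rw [one_pow, mul_one, mul_pow, mul_comm, ← map_natCast (C (R := ℚ)), coeff_C_mul,
      coeff_X_pow_mul']
    split_ifs <;> simp
  rw [sum_congr rfl hterm]
  symm
  -- The `j`-th binomial term is nonzero only if `n - j = 2 * k` for some `k` and `1 ≤ j`.
  apply sum_of_injOn (fun k => n - 2 * k)
  · intro a ha b hb hab
    simp at ha hb hab
    omega
  · intro a ha
    simp at ha ⊢
    omega
  · intro j hj hj'
    rw [ite_eq_right_iff]
    intro hjn
    rcases j with _ | d
    · have : n ≠ 0 := by omega
      simp [coeff_one, this]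
    · rw [hpow, coeff_mk, if_neg, mul_zero]
      rintro ⟨r, hr⟩
      apply hj'
      refine ⟨r, ?_, ?_⟩
      · simp; omega
      · simp; omega
  · intro k hk
    simp only [mem_Icc] at hk
    obtain ⟨d, hd⟩ : ∃ d, n = d + 1 + 2 * k := ⟨n - 2 * k - 1, by omega⟩
    have e1 : n - 2 * k = d + 1 := by omega
    have e2 : n - (d + 1) = k + k := by omega
    rw [e1, if_pos (by omega), hpow, coeff_mk, e2, if_pos ⟨k, rfl⟩,
      show (k + k) / 2 = k by omega, show n - k - 1 = d + k by omega,
      Nat.choose_symm_add, ← Nat.choose_symm (show d + 1 ≤ n + 1 by omega),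
      show n + 1 - (d + 1) = 2 * k + 1 by omega]

theorem stepCount_closed_form (n : ℕ) (hn : 1 ≤ n) :
    ((stepCount stepWeight n 0 : ℕ) : ℚ) =
      ∑ k ∈ Icc 0 ((n - 1) / 2),
        (1 / (2 * (k : ℚ) + 1)) * ((n - k - 1).choose k : ℚ) * (n.choose (2 * k) : ℚ) := by
  have hcast : ∀ p q, ((stepCount stepWeight p q : ℕ) : ℚ) =
      stepCount (stepWeight (R := ℚ)) p q := by
    intro p
    induction p with
    | zero => intro q; simp [stepCount]
    | succ p ih => intro q; simp [stepCount, ih, stepWeight]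
  have h := stepCount_zero_right (PowerSeries.mk (stepWeight (R := ℚ))) (by simp [stepWeight]) n
  simp only [coeff_mk] at h
  rw [coeff_stepWeight_pow n hn] at h
  have hn0 : (n + 1 : ℚ) ≠ 0 := by positivity
  apply mul_left_cancel₀ hn0
  rw [hcast, show (stepWeight : ℕ → ℚ) = fun e => stepWeight e from rfl, h, mul_sum]
  refine sum_congr rfl fun k _ => ?_
  have hc : ((n + 1 : ℕ) : ℚ) * (n.choose (2 * k) : ℚ) =
      ((n + 1).choose (2 * k + 1) : ℚ) * ((2 * k + 1 : ℕ) : ℚ) := by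
    exact_mod_cast Nat.add_one_mul_choose_eq n (2 * k)
  push_cast at hc
  field_simp
  linear_combination -((n - k - 1).choose k : ℚ) * hc

end Walks

/-! ### Permutations as words -/

/-- `l` avoids `123`, expressed by recursion on the first letter. -/
def ListAvoids : List ℕ → Prop
  | [] => True
  | x :: l => l.Pairwise (fun a b => ¬(x < a ∧ a < b)) ∧ ListAvoids l

/-- `l` is Jacobi: for each letter `x`, the block of larger letters right after `x` has even
length. -/
def ListJacobi : List ℕ → Prop
  | [] => True
  | x :: l => Even (l.takeWhile (x < ·)).length ∧ ListJacobi l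

theorem listAvoids_ofFn {n : ℕ} (f : Fin n → ℕ) :
    ListAvoids (List.ofFn f) ↔ ∀ a b c, a < b → b < c → ¬(f a < f b ∧ f b < f c) := by
  induction n with
  | zero => simp [ListAvoids]
  | succ n ih =>
    rw [List.ofFn_succ, ListAvoids, ih, List.pairwise_ofFn]
    simp only [Fin.forall_fin_succ (n := n), Fin.succ_lt_succ_iff, Fin.not_lt_zero, Fin.succ_pos,
      false_implies, implies_true, true_and, true_implies]

theorem length_takeWhile_ofFn {n : ℕ} (f : Fin n → ℕ) (x : ℕ) :
    ((List.ofFn f).takeWhile (x < ·)).length =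
      (Finset.univ.filter fun j : Fin n => ∀ k ≤ j, x < f k).card := by
  induction n with
  | zero => simp
  | succ n ih =>
    rw [List.ofFn_succ, List.takeWhile_cons, Fin.card_filter_univ_succ]
    simp only [Fin.forall_fin_succ (n := n), Fin.succ_le_succ_iff]
    by_cases h : x < f 0
    · simp [h, ih]
    · simp [h]

theorem listJacobi_ofFn {n : ℕ} (f : Fin n → ℕ) :
    ListJacobi (List.ofFn f) ↔ ∀ i,
      Even (Finset.univ.filter fun j : Fin n => i < j ∧ ∀ k, i < k → k ≤ j → f i < f k).card := by
  induction n with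
  | zero => simp [ListJacobi]
  | succ n ih =>
    rw [List.ofFn_succ, ListJacobi, ih, length_takeWhile_ofFn, Fin.forall_fin_succ]
    simp only [Fin.card_filter_univ_succ]
    simp [Fin.forall_fin_succ (n := n)]

theorem avoids_pattern123_iff {n : ℕ} (π : Equiv.Perm (Fin n)) :
    Avoids π pattern123 ↔ ∀ a b c, a < b → b < c → ¬(π a < π b ∧ π b < π c) := by
  constructor
  · intro h a b c hab hbc hp
    have hm : StrictMono ![a, b, c] := by
      rw [Fin.strictMono_iff_lt_succ]
      intro i
      fin_cases i <;> simpa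
    have hm' : StrictMono (fun i => π (![a, b, c] i)) := by
      rw [Fin.strictMono_iff_lt_succ]
      intro i
      fin_cases i
      exacts [hp.1, hp.2]
    exact h (OrderEmbedding.ofStrictMono _ hm) fun i j => hm'.lt_iff_lt
  · intro h f hf
    exact h (f 0) (f 1) (f 2) (f.strictMono (by decide)) (f.strictMono (by decide))
      ⟨(hf 0 1).2 (by decide), (hf 1 2).2 (by decide)⟩

/-! ### Words that complete a given prefix -/

/-- The `123`-avoiding Jacobi words on the set of letters `U` whose first letter, if any, is
less than `t`. -/
def wordsBelow (U : Finset ℕ) (t : ℕ) : Set (List ℕ) :=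
  {l | l.Nodup ∧ l.toFinset = U ∧ ListAvoids l ∧ ListJacobi l ∧ ∀ x ∈ l.head?, x < t}

/-- The Jacobi words `l` on the set of letters `U` such that `t :: l` avoids `123` and the initial run
of letters above `t` in `l` has the parity of `s`. They are the completions of a word whose current
left-to-right minimum is `t` and in which `s` letters of `ρ(t)` are already placed. -/
def blockWords (U : Finset ℕ) (t s : ℕ) : Set (List ℕ) :=
  {l | l.Nodup ∧ l.toFinset = U ∧ ListAvoids (t :: l) ∧ ListJacobi l ∧
    Even ((l.takeWhile (t < ·)).length + s)}

/-- One-line notation: the bound on the first letter holds for every word on `{0, …, n - 1}`. -/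
theorem encard_jacobiAvoiding (n : ℕ) :
    (jacobiAvoiding n pattern123).encard = (wordsBelow (Finset.range n) n).encard := by
  have hinj : Function.Injective (fun π : Equiv.Perm (Fin n) => List.ofFn fun i => (π i : ℕ)) := by
    intro π σ h
    ext i
    exact congrFun (List.ofFn_injective h) i
  rw [← hinj.encard_image]
  congr 1
  ext l
  constructor
  · rintro ⟨π, ⟨hJ, hA⟩, rfl⟩
    refine ⟨?_, ?_, ?_, ?_, ?_⟩
    · rw [List.nodup_ofFn]
      exact Fin.val_injective.comp π.injective
    · ext x
      simp only [List.mem_toFinset, List.mem_ofFn, Finset.mem_range]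
      constructor
      · rintro ⟨i, rfl⟩
        exact (π i).2
      · intro hx
        exact ⟨π.symm ⟨x, hx⟩, by simp⟩
    · rw [listAvoids_ofFn]
      exact (avoids_pattern123_iff π).1 hA
    · rw [listJacobi_ofFn]
      exact hJ
    · intro x hx
      have := List.mem_of_mem_head? hx
      rw [List.mem_ofFn] at this
      obtain ⟨i, rfl⟩ := this
      exact (π i).2
  · rintro ⟨hnd, hU, hA, hJ, -⟩
    have hlen : l.length = n := by
      rw [← List.toFinset_card_of_nodup hnd, hU, Finset.card_range]
    subst hlen
    have hlt : ∀ i : Fin l.length, l.get i < l.length := fun i => by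
      rw [← Finset.mem_range, ← hU]
      simp
    let f : Fin l.length → Fin l.length := fun i => ⟨l.get i, hlt i⟩
    have hf : Function.Injective f := fun i j hij =>
      List.nodup_iff_injective_get.1 hnd (by simpa [f] using hij)
    have hl : l = List.ofFn fun i => (f i : ℕ) := by simp [f]
    refine ⟨Equiv.ofBijective f (Finite.injective_iff_bijective.1 hf), ⟨?_, ?_⟩, hl.symm⟩
    · have hJ' : ListJacobi (List.ofFn fun i => (f i : ℕ)) := hl ▸ hJ
      exact (listJacobi_ofFn _).1 hJ'
    · have hA' : ListAvoids (List.ofFn fun i => (f i : ℕ)) := hl ▸ hA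
      exact (avoids_pattern123_iff _).2 ((listAvoids_ofFn _).1 hA')

theorem toFinset_eq_erase_of_cons {x : ℕ} {l : List ℕ} {U : Finset ℕ} (hx : x ∉ l)
    (h : (x :: l).toFinset = U) : l.toFinset = U.erase x := by
  rw [← h, List.toFinset_cons, Finset.erase_insert (by simpa using hx)]

/-- The first letter is either `t`, which opens a block, or less than `t`. -/
theorem wordsBelow_succ {U : Finset ℕ} {t : ℕ} (ht : t ∈ U) :
    wordsBelow U (t + 1) = (t :: ·) '' blockWords (U.erase t) t 0 ∪ wordsBelow U t := by
  ext l
  constructor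
  · rintro ⟨hnd, hU, hA, hJ, hh⟩
    rcases l with _ | ⟨x, l⟩
    · exact Or.inr ⟨hnd, hU, hA, hJ, by simp⟩
    · rcases Nat.lt_succ_iff_lt_or_eq.1 (hh x rfl) with h | rfl
      · exact Or.inr ⟨hnd, hU, hA, hJ, by simpa using h⟩
      · have hn := List.nodup_cons.1 hnd
        exact Or.inl ⟨l, ⟨hn.2, toFinset_eq_erase_of_cons hn.1 hU, hA, hJ.2, hJ.1⟩, rfl⟩
  · rintro (⟨l, ⟨hnd, hU, hA, hJ, he⟩, rfl⟩ | ⟨hnd, hU, hA, hJ, hh⟩)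
    · have htl : t ∉ l := by rw [← List.mem_toFinset, hU]; simp
      exact ⟨List.nodup_cons.2 ⟨htl, hnd⟩,
        by rw [List.toFinset_cons, hU, Finset.insert_erase ht], hA, ⟨he, hJ⟩, by simp⟩
    · exact ⟨hnd, hU, hA, hJ, fun x hx => (hh x hx).trans t.lt_succ_self⟩

/-- If the first letter is below `t`, it ends the block of `t` and is the new left-to-right minimum. -/
theorem mem_blockWords_of_head_lt {U : Finset ℕ} {t s : ℕ} {l : List ℕ}
    (hh : ∀ x ∈ l.head?, x < t) : l ∈ blockWords U t s ↔ Even s ∧ l ∈ wordsBelow U t := by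
  have hw : l.takeWhile (t < ·) = [] := by
    rcases l with _ | ⟨x, l⟩
    · rfl
    · simpa using (hh x rfl).le
  have hA : ListAvoids (t :: l) ↔ ListAvoids l := by
    refine ⟨fun h => h.2, fun h => ⟨?_, h⟩⟩
    rcases l with _ | ⟨x, l⟩
    · simp
    · have hx := hh x rfl
      exact List.pairwise_cons.2 ⟨fun b _ hb => by omega,
        h.1.imp fun hab hb => hab ⟨hx.trans hb.1, hb.2⟩⟩
  simp only [blockWords, wordsBelow, Set.mem_ofPred_eq, hw, hA, List.length_nil, zero_add]
  tauto

theorem blockWords_of_forall_lt {U : Finset ℕ} {t : ℕ} (hU : ∀ x ∈ U, x < t) (s : ℕ) :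
    blockWords U t s = {l | Even s ∧ l ∈ wordsBelow U t} := by
  ext l
  constructor
  · intro h
    refine (mem_blockWords_of_head_lt fun x hx => hU x ?_).1 h
    rw [← h.2.1]
    simpa using List.mem_of_mem_head? hx
  · intro h
    exact (mem_blockWords_of_head_lt h.2.2.2.2.2).2 h

/-- A letter that continues the block of `t` must be the largest remaining one: otherwise `t`, that
letter and the largest one form a `123`. -/
theorem blockWords_of_max {U : Finset ℕ} {t M : ℕ} (htU : t ∉ U) (hM : M ∈ U) (htM : t < M)
    (hmax : ∀ x ∈ U, x ≤ M) (s : ℕ) :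
    blockWords U t s =
      {l | Even s ∧ l ∈ wordsBelow U t} ∪ (M :: ·) '' blockWords (U.erase M) t (s + 1) := by
  ext l
  constructor
  · intro h
    by_cases hh : ∀ x ∈ l.head?, x < t
    · exact Or.inl ((mem_blockWords_of_head_lt hh).1 h)
    · obtain ⟨hnd, hU, hA, hJ, he⟩ := h
      rcases l with _ | ⟨x, l⟩
      · simp at hh
      have hxU : x ∈ U := by rw [← hU]; simp
      have htx : t < x := by
        have : x ≠ t := fun h => htU (h ▸ hxU)
        simp at hh
        omega
      have hp := List.pairwise_cons.1 hA.1
      obtain rfl : x = M := by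
        by_contra hne
        have hMl : M ∈ x :: l := by rw [← List.mem_toFinset, hU]; exact hM
        rcases List.mem_cons.1 hMl with h | h
        · exact hne h.symm
        · exact hp.1 M h ⟨htx, lt_of_le_of_ne (hmax x hxU) hne⟩
      have hn := List.nodup_cons.1 hnd
      refine Or.inr ⟨l, ⟨hn.2, toFinset_eq_erase_of_cons hn.1 hU, ⟨hp.2, hA.2.2⟩, hJ.2, ?_⟩, rfl⟩
      rw [List.takeWhile_cons, if_pos (by simpa using htx), List.length_cons] at he
      rwa [← add_assoc, add_right_comm]
  · rintro (h | ⟨l, ⟨hnd, hU, hA, hJ, he⟩, rfl⟩)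
    · exact (mem_blockWords_of_head_lt h.2.2.2.2.2).2 h
    · have hMl : M ∉ l := by rw [← List.mem_toFinset, hU]; simp
      have hle : ∀ x ∈ l, x ≤ M := fun x hx => by
        rw [← List.mem_toFinset, hU] at hx
        exact hmax x (Finset.mem_of_mem_erase hx)
      refine ⟨List.nodup_cons.2 ⟨hMl, hnd⟩,
        by rw [List.toFinset_cons, hU, Finset.insert_erase hM], ⟨?_, ?_, hA.2⟩, ⟨?_, hJ⟩, ?_⟩
      · exact List.pairwise_cons.2 ⟨fun b hb h => (hle b hb).not_gt h.2, hA.1⟩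
      · exact List.pairwise_of_forall_mem_list fun a ha b _ h => (hle a ha).not_gt h.1
      · have : l.takeWhile (M < ·) = [] := by
          rw [List.takeWhile_eq_nil_iff]
          intro h0
          simpa using hle _ (List.getElem_mem h0)
        simp [this]
      · rw [List.takeWhile_cons, if_pos (by simpa using htM), List.length_cons]
        rwa [← add_assoc, add_right_comm] at he

/-! ### The recursion for the number of words -/

theorem encard_wordsBelow_zero (U : Finset ℕ) :
    (wordsBelow U 0).encard = if U.card = 0 then 1 else 0 := by
  split_ifs with h <;> rw [Finset.card_eq_zero] at h
  · rw [Set.encard_eq_one]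
    refine ⟨[], Set.eq_singleton_iff_unique_mem.2 ⟨?_, ?_⟩⟩
    · simp [wordsBelow, h, ListAvoids, ListJacobi]
    · rintro l ⟨-, hU, -⟩
      simpa [h] using hU
  · rw [Set.encard_eq_zero, Set.eq_empty_iff_forall_notMem]
    rintro l ⟨-, hU, -, -, hh⟩
    rcases l with _ | ⟨x, l⟩
    · exact h (by simpa using hU.symm)
    · simpa using hh x rfl

/-- The index `x.1` is the number of letters with which the block of `t` is continued. -/
theorem encard_blockWords {t : ℕ} (c : ℕ → ℕ)
    (hc : ∀ U : Finset ℕ, Finset.range t ⊆ U →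
      (wordsBelow U t).encard = c (U.filter (t ≤ ·)).card) (q : ℕ) (U : Finset ℕ)
    (hU : Finset.range t ⊆ U) (htU : t ∉ U) (hq : (U.filter (t ≤ ·)).card = q) (s : ℕ) :
    (blockWords U t s).encard =
      ((∑ x ∈ Finset.HasAntidiagonal.antidiagonal q, if Even (s + x.1) then c x.2 else 0 : ℕ) : ℕ∞) := by
  have hsep : ∀ (V : Finset ℕ) (s : ℕ), Finset.range t ⊆ V → {l | Even s ∧ l ∈ wordsBelow V t}.encard =
      ((if Even s then c (V.filter (t ≤ ·)).card else 0 : ℕ) : ℕ∞) := by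
    intro V s hV
    split_ifs with h <;> simp [h, hc V hV]
  induction q generalizing U s with
  | zero =>
    rw [blockWords_of_forall_lt, hsep U s hU, hq]
    · simp
    · intro x hx
      rw [Finset.card_eq_zero, Finset.filter_eq_empty_iff] at hq
      exact not_le.1 (hq hx)
  | succ q ih =>
    have hne : (U.filter (t ≤ ·)).Nonempty := by
      rw [← Finset.card_pos]; omega
    obtain ⟨M, hMf, hmaxf⟩ := Finset.exists_max_image _ id hne
    obtain ⟨hM, htM⟩ := Finset.mem_filter.1 hMf
    have hmax : ∀ x ∈ U, x ≤ M := fun x hx => by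
      by_cases h : t ≤ x
      · exact hmaxf x (Finset.mem_filter.2 ⟨hx, h⟩)
      · omega
    have htM' : t < M := lt_of_le_of_ne htM fun h => htU (h ▸ hM)
    rw [blockWords_of_max htU hM htM' hmax, Set.encard_union_eq, hsep U s hU, hq,
      (List.cons_injective).encard_image, ih (U.erase M), Finset.Nat.sum_antidiagonal_succ]
    · push_cast
      simp only [add_zero, add_assoc, add_comm 1]
    · intro x hx
      have := Finset.mem_range.1 hx
      exact Finset.mem_erase.2 ⟨by omega, hU hx⟩
    · simp [htU]
    · rw [Finset.filter_erase, Finset.card_erase_of_mem hMf, hq, Nat.add_sub_cancel]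
    · rw [Set.disjoint_left]
      rintro _ h ⟨l, -, rfl⟩
      have := h.2.2.2.2.2 M rfl
      omega

/-- The words depend on `U` only through the number of letters that are at least `t`, which is the
starting height of the walks. -/
theorem encard_wordsBelow (t : ℕ) (U : Finset ℕ) (hU : Finset.range t ⊆ U) :
    (wordsBelow U t).encard = (stepCount stepWeight t (U.filter (t ≤ ·)).card : ℕ) := by
  induction t generalizing U with
  | zero => simp [encard_wordsBelow_zero, stepCount]
  | succ t ih =>
    have ht : t ∈ U := hU (by simp)
    have hU' : Finset.range t ⊆ U := (Finset.range_subset_range.2 t.le_succ).trans hU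
    have hcard : (U.filter (t ≤ ·)).card = (U.filter (t + 1 ≤ ·)).card + 1 := by
      rw [← Finset.card_insert_of_notMem (a := t) (by simp)]
      congr 1
      ext x
      simp only [Finset.mem_filter, Finset.mem_insert]
      constructor
      · rintro ⟨h1, h2⟩
        by_cases h : x = t
        · exact Or.inl h
        · exact Or.inr ⟨h1, by omega⟩
      · rintro (rfl | ⟨h1, h2⟩)
        · exact ⟨ht, le_rfl⟩
        · exact ⟨h1, by omega⟩
    rw [wordsBelow_succ ht, Set.encard_union_eq, (List.cons_injective).encard_image,
      encard_blockWords _ ih (U.filter (t + 1 ≤ ·)).card (U.erase t), ih U hU', hcard, stepCount,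
      Finset.Nat.sum_antidiagonal_succ]
    · push_cast
      simp [stepWeight, Nat.odd_add_one, add_comm]
    · intro x hx
      have := Finset.mem_range.1 hx
      exact Finset.mem_erase.2 ⟨by omega, hU' hx⟩
    · simp
    · rw [Finset.filter_erase, Finset.card_erase_of_mem (by simp [ht]), hcard, Nat.add_sub_cancel]
    · rw [Set.disjoint_left]
      rintro _ ⟨l, -, rfl⟩ h
      exact lt_irrefl t (h.2.2.2.2 t rfl)

end JacobiPerm

theorem theorem5p1 (n : ℕ) (hn : 1 ≤ n) :
    (JacobiPerm.jacobiCount n JacobiPerm.pattern123 : ℚ) =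
      ∑ k ∈ Finset.Icc 0 ((n - 1) / 2),
        (1 / (2 * (k : ℚ) + 1)) * ((n - k - 1).choose k : ℚ) * (n.choose (2 * k) : ℚ) := by
  have hempty : (Finset.range n).filter (n ≤ ·) = ∅ := by
    rw [Finset.filter_eq_empty_iff]
    intro x hx
    simpa using hx
  rw [JacobiPerm.jacobiCount, Set.ncard_def, JacobiPerm.encard_jacobiAvoiding,
    JacobiPerm.encard_wordsBelow n _ subset_rfl, hempty, Finset.card_empty, ENat.toNat_natCast,
    JacobiPerm.stepCount_closed_form n hn]
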